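/- Let $d \ge 1$ be an integer and $\beta > 0$ a real number. For each $N \ge 0$ let $G(N)$ be the random graph with vertex set $\{0,1,\dots,N\}^d$ in which any two sites $x,y$ with $\|x-y\|_1 = 1$ are always joined by an edge and every other pair of distinct sites $x,y$ is joined by an edge with probability $1-\exp\bigl(-\beta/\|x-y\|_1^{d}\bigr)$, independently over all unordered pairs. Let $D_N$ be the diameter of $G(N)$ in the graph distance. Then for every $\varepsilon > 0$, $$\lim_{N\to\infty} \mathbb{P}\left( D_N \le \frac{(1+\varepsilon)\, d \log N}{\log\log N} \right) = 1.$$ In particular, $D_N \dfrac{\log\log N}{\log N} \to d$ in probability as $N \to \infty$, that is, for every $\delta > 0$, $$\lim_{N\to\infty} \mathbb{P}\left( \left| D_N \frac{\log\log N}{\log N} - d \right| \ge \delta \right) = 0.$$ -/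

import Mathlib

open MeasureTheory ProbabilityTheory Filter Topology

namespace LongRangePercolation

/-- The box `{0, 1, …, N}^d`. -/
abbrev Box (d N : ℕ) : Type := Fin d → Fin (N + 1)

/-- The `ℓ¹`-distance `‖x - y‖₁` between two sites of the box. -/
def l1Dist {d N : ℕ} (x y : Box d N) : ℕ :=
  ∑ i, ((x i : ℤ) - (y i : ℤ)).natAbs

theorem l1Dist_comm {d N : ℕ} (x y : Box d N) : l1Dist x y = l1Dist y x :=
  Finset.sum_congr rfl fun _ _ => by omega

theorem l1Dist_self {d N : ℕ} (x : Box d N) : l1Dist x x = 0 := by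
  simp [l1Dist]

/-- The connection probability `1 - exp (-β / r^d)` of two sites at `ℓ¹`-distance `r`. -/
noncomputable def connProb (d : ℕ) (β : ℝ) (hβ : 0 < β) (r : ℕ) : unitInterval :=
  ⟨1 - Real.exp (-(β / (r : ℝ) ^ d)), by
    have h : 0 ≤ β / (r : ℝ) ^ d := by positivity
    exact ⟨sub_nonneg.2 (Real.exp_le_one_iff.2 (neg_nonpos.2 h)),
      sub_le_self _ (Real.exp_pos _).le⟩⟩

/-- The connection probability `1 - exp (-β / ‖x - y‖₁^d)` of an unordered pair `{x, y}`. -/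
noncomputable def pairProb (d N : ℕ) (β : ℝ) (hβ : 0 < β) (e : Sym2 (Box d N)) : unitInterval :=
  Sym2.lift ⟨fun x y => connProb d β hβ (l1Dist x y), fun x y => congrArg _ (l1Dist_comm x y)⟩ e

/-- A configuration assigns to every unordered pair of sites a bit: open or not. -/
abbrev Config (d N : ℕ) : Type := Sym2 (Box d N) → Bool

/-- The law of the configuration: the bits are independent, and the bit of `{x, y}` is `true`
with probability `1 - exp (-β / ‖x - y‖₁^d)`. -/
noncomputable def law (d N : ℕ) (β : ℝ) (hβ : 0 < β) : Measure (Config d N) :=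
  Measure.pi fun e => bernoulliMeasure true false (pairProb d N β hβ e)

/-- The percolation graph `G(N)` of a configuration: nearest neighbours are always joined (their
bits are ignored), and any other two distinct sites are joined if their bit is `true`. -/
def graph {d N : ℕ} (ω : Config d N) : SimpleGraph (Box d N) where
  Adj x y := l1Dist x y = 1 ∨ (x ≠ y ∧ ω s(x, y) = true)
  symm := ⟨fun x y h => by
    rcases h with h | ⟨h, h'⟩
    · exact Or.inl (by rw [l1Dist_comm]; exact h)
    · exact Or.inr ⟨h.symm, by rw [Sym2.eq_swap]; exact h'⟩⟩
  loopless := ⟨fun x h => by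
    rcases h with h | h
    · simp [l1Dist_self] at h
    · exact h.1 rfl⟩

/-- The diameter `D_N` of the percolation graph, in the graph distance. -/
noncomputable def diameter {d N : ℕ} (ω : Config d N) : ℕ := (graph ω).diam

end LongRangePercolation

open LongRangePercolation

/-! Write L = log N. The decay exponent equals the dimension, so every dyadic annulus around a site
contributes a constant to its expected degree, which is therefore of order L. Reaching all N^d sites
at growth rate L per step takes about d L / log L steps, and both bounds make this precise.

Lower bound: decomposing self-avoiding paths at their first step bounds the expected number of sites
within distance K of a fixed site by (1 + O(L))^K (`sum_law_conn_le`). If the diameter is at most K,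
this ball is the whole box, so `law_diameter_le_le` gives a probability of at most (O(L))^K / N^d.
This vanishes for K = γ L / log L with γ < d.

Upper bound: explore from both endpoints until two fronts of size W ≥ N^{d/2} L are reached, which
takes about d L / (2 log L) rounds each. There are then W^2 ≥ N^d L^2 pairs between the fronts, each
open with probability of order at least N^{-d}, so some edge joins them except with probability
exp(-c L^2). One round multiplies a front by m, of order L, by a Chernoff bound over the sites
outside the used region (`law_card_nbrs_lt_le`). Rounds use disjoint sets of edges, hence are
independent (`law_compl_conn_succ_le`).

A union bound over N^{2d} pairs requires failures smaller than every power of N. The exploration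
therefore starts not from one site but from a segment of s sites, s a small multiple of L / log L: a
round then fails with probability at most exp(-s m), where s m is of order L^2 / log L, and walking
inside the segments costs only a small fraction of the allowed length. -/

namespace LongRangePercolation

/-! ### Independence and a Chernoff bound for product measures. -/

section Product

variable {ι : Type*} [Fintype ι] (μ : ι → Measure Bool) [∀ i, IsProbabilityMeasure (μ i)]

/-- Functions of disjoint sets of coordinates are independent under a product measure. -/
theorem indepFun_of_dependsOn {α γ : Type*} [Nonempty α] [Nonempty γ] [MeasurableSpace α]
    [MeasurableSpace γ]
    {f : (ι → Bool) → α} {g : (ι → Bool) → γ} {I J : Set ι} (hf : DependsOn f I)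
    (hg : DependsOn g J) (hIJ : Disjoint I J) : IndepFun f g (Measure.pi μ) := by
  classical
  obtain ⟨f', rfl⟩ := dependsOn_iff_exists_comp.1 hf
  obtain ⟨g', rfl⟩ := dependsOn_iff_exists_comp.1 hg
  have h : iIndepFun (fun i (ω : ι → Bool) => ω i) (Measure.pi μ) :=
    iIndepFun_pi (X := fun _ => id) (fun _ => aemeasurable_id)
  have h' := h.indepFun_finset I.toFinite.toFinset J.toFinite.toFinset
    (by simpa [Set.disjoint_iff_inter_eq_empty, ← Finset.disjoint_coe] using hIJ)
    (fun i => measurable_pi_apply i)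
  exact h'.comp (φ := fun x => f' fun i => x ⟨i, by simp⟩)
    (ψ := fun x => g' fun i => x ⟨i, by simp⟩) (measurable_of_finite _) (measurable_of_finite _)

theorem measureReal_inter_of_dependsOn {S T : Set (ι → Bool)} {I J : Set ι}
    (hS : DependsOn (· ∈ S) I) (hT : DependsOn (· ∈ T) J) (hIJ : Disjoint I J) :
    (Measure.pi μ).real (S ∩ T) = (Measure.pi μ).real S * (Measure.pi μ).real T := by
  have h := (indepFun_of_dependsOn μ hS hT hIJ).measure_inter_preimage_eq_mul {True} {True}
    trivial trivial
  have e : ∀ S : Set (ι → Bool), (· ∈ S) ⁻¹' {True} = S := fun S => by ext; simp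
  rw [e, e] at h
  simp [measureReal_def, h]

theorem integral_prod_of_dependsOn {κ : Type*} (s : Finset κ) (f : κ → (ι → Bool) → ℝ)
    (I : κ → Set ι) (hf : ∀ v ∈ s, DependsOn (f v) (I v))
    (hI : (s : Set κ).PairwiseDisjoint I) :
    ∫ ω, ∏ v ∈ s, f v ω ∂(Measure.pi μ) = ∏ v ∈ s, ∫ ω, f v ω ∂(Measure.pi μ) := by
  classical
  induction s using Finset.induction_on with
  | empty => simp
  | insert a s ha ih =>
    simp only [Finset.prod_insert ha]
    rw [← ih (fun v hv => hf v (by simp [hv])) (hI.subset (by simp))]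
    have hd : DependsOn (fun ω => ∏ v ∈ s, f v ω) (⋃ v ∈ s, I v) := fun x y hxy =>
      Finset.prod_congr rfl fun v hv => hf v (by simp [hv]) fun i hi =>
        hxy i (Set.mem_biUnion hv hi)
    refine (indepFun_of_dependsOn μ (hf a (by simp)) hd ?_).integral_fun_mul_eq_mul_integral
      (measurable_of_finite _).aestronglyMeasurable (measurable_of_finite _).aestronglyMeasurable
    rw [Set.disjoint_iUnion₂_right]
    exact fun v hv => hI (by simp) (by simp [hv]) (by rintro rfl; exact ha hv)

/-- A Chernoff bound for the lower tail of a number of independent events. -/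
theorem measureReal_card_lt_le {κ : Type*} (s : Finset κ) (E : κ → Set (ι → Bool))
    [∀ ω, DecidablePred fun v => ω ∈ E v]
    (I : κ → Set ι) (hE : ∀ v ∈ s, DependsOn (· ∈ E v) (I v))
    (hI : (s : Set κ).PairwiseDisjoint I) (q : κ → ℝ)
    (hq : ∀ v ∈ s, q v ≤ (Measure.pi μ).real (E v)) (hq0 : ∀ v ∈ s, 0 ≤ q v) (M : ℕ) :
    (Measure.pi μ).real {ω | (s.filter fun v => ω ∈ E v).card < M} ≤
      Real.exp (M - (∑ v ∈ s, q v) / 2) := by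
  set P := Measure.pi μ
  -- Markov's inequality for exp(-count): each factor has mean 1 - (1 - 1/e) P(E v) ≤ 1 - q v / 2 ≤
  -- exp(-q v / 2).
  let f : κ → (ι → Bool) → ℝ := fun v ω => if ω ∈ E v then Real.exp (-1) else 1
  have hprod : ∀ ω, ∏ v ∈ s, f v ω = Real.exp (-((s.filter fun v => ω ∈ E v).card : ℝ)) := by
    intro ω
    simp only [f, Finset.prod_ite, Finset.prod_const, one_pow, mul_one]
    rw [← Real.exp_nat_mul]
    congr 1; ring
  have hmarkov : P.real {ω | (s.filter fun v => ω ∈ E v).card < M} ≤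
      ∫ ω, Real.exp M * ∏ v ∈ s, f v ω ∂P := by
    rw [← integral_indicator_one (Set.toFinite _).measurableSet]
    refine integral_mono (Integrable.of_finite) (Integrable.of_finite) fun ω => ?_
    simp only [Set.indicator_apply, Set.mem_ofPred_eq, Pi.one_apply]
    split_ifs with h
    · rw [hprod, ← Real.exp_add]
      refine Real.one_le_exp ?_
      have : ((s.filter fun v => ω ∈ E v).card : ℝ) ≤ M := by exact_mod_cast h.le
      linarith
    · rw [hprod]; positivity
  refine hmarkov.trans ?_
  rw [integral_const_mul, integral_prod_of_dependsOn μ s f I ?_ hI, sub_eq_add_neg, Real.exp_add,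
    ← neg_div, ← Finset.sum_neg_distrib, Finset.sum_div, Real.exp_sum]
  · refine mul_le_mul_of_nonneg_left ?_ (Real.exp_pos _).le
    refine Finset.prod_le_prod (fun v _ => integral_nonneg fun ω => ?_) fun v hv => ?_
    · simp only [f]; split_ifs <;> positivity
    · have h1 : f v = fun ω => 1 - (1 - Real.exp (-1)) * (E v).indicator 1 ω := by
        funext ω
        simp only [f, Set.indicator_apply, Pi.one_apply]
        split_ifs <;> ring
      rw [h1, integral_sub Integrable.of_finite Integrable.of_finite, integral_const_mul,
        integral_indicator_one (Set.toFinite _).measurableSet]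
      simp only [integral_const, probReal_univ, smul_eq_mul, mul_one]
      have h2 : Real.exp (-1) ≤ 1 / 2 := by
        rw [Real.exp_neg, inv_eq_one_div]
        have := Real.add_one_le_exp (1 : ℝ)
        exact one_div_le_one_div_of_le (by norm_num) (by linarith)
      have h3 := Real.add_one_le_exp (-q v / 2)
      nlinarith [hq v hv, hq0 v hv]
  · intro v hv x y hxy
    have := hE v hv hxy
    simp only [f]
    simp only [eq_iff_iff] at this
    simp [this]

end Product

instance isProbabilityMeasure_law (d N : ℕ) (β : ℝ) (hβ : 0 < β) :
    IsProbabilityMeasure (law d N β hβ) := by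
  unfold law; infer_instance

end LongRangePercolation

/-! ### Connection events and exploration by independent rounds. -/

namespace LongRangePercolation

variable {d N : ℕ}

/-- `X` and `Y` are joined by a walk of length at most `k` that avoids `D`. -/
def conn (D X Y : Finset (Box d N)) (k : ℕ) : Set (Config d N) :=
  {ω | ∃ x ∈ X, ∃ y ∈ Y, ∃ p : (graph ω).Walk x y, p.length ≤ k ∧ ∀ v ∈ p.support, v ∉ D}

open scoped Classical in
/-- The sites outside `Z` that have a neighbour in `X`. -/
noncomputable def nbrs (X Z : Finset (Box d N)) (ω : Config d N) : Finset (Box d N) :=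
  Finset.univ.filter fun v => v ∉ Z ∧ ∃ x ∈ X, (graph ω).Adj x v

theorem graph_adj_congr {ω ω' : Config d N} {x y : Box d N} (h : ω s(x, y) = ω' s(x, y)) :
    (graph ω).Adj x y ↔ (graph ω').Adj x y := by
  simp [graph, h]

/-- A walk transfers to any configuration agreeing on its edges. Hence walks avoiding `D` are
independent of revealed pairs that have an endpoint in `D`. -/
theorem dependsOn_conn (D X Y : Finset (Box d N)) (k : ℕ) :
    DependsOn (· ∈ conn D X Y k) {e | ∀ v ∈ e, v ∉ D} := by
  have key : ∀ ω ω' : Config d N, (∀ e ∈ {e | ∀ v ∈ e, v ∉ D}, ω e = ω' e) →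
      ω ∈ conn D X Y k → ω' ∈ conn D X Y k := by
    rintro ω ω' h ⟨x, hx, y, hy, p, hp, hD⟩
    have hE : ∀ e ∈ p.edges, e ∈ (graph ω').edgeSet := by
      intro e he
      induction e using Sym2.ind with
      | _ a b =>
        have ha := hD _ (p.fst_mem_support_of_mem_edges he)
        have hb := hD _ (p.snd_mem_support_of_mem_edges he)
        rw [SimpleGraph.mem_edgeSet, ← graph_adj_congr (h s(a, b) ?_)]
        · exact p.adj_of_mem_edges he
        · intro v hv
          rcases Sym2.mem_iff.1 hv with rfl | rfl <;> assumption
    exact ⟨x, hx, y, hy, p.transfer _ hE, by simpa using hp, by simpa using hD⟩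
  exact fun ω ω' h => propext ⟨key ω ω' h, key ω' ω fun e he => (h e he).symm⟩

theorem conn_comm (D X Y : Finset (Box d N)) (k : ℕ) : conn D X Y k = conn D Y X k := by
  have key : ∀ X Y : Finset (Box d N), conn D X Y k ⊆ conn D Y X k := by
    rintro X Y ω ⟨x, hx, y, hy, p, hp, hD⟩
    exact ⟨y, hy, x, hx, p.reverse, by simpa using hp, by simpa using hD⟩
  exact (key X Y).antisymm (key Y X)

theorem dependsOn_nbrs (X Z : Finset (Box d N)) :
    DependsOn (nbrs X Z) {e | ∃ x ∈ X, ∃ v ∉ Z, e = s(x, v)} := by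
  intro ω ω' h
  ext v
  simp only [nbrs, Finset.mem_filter, Finset.mem_univ, true_and]
  refine and_congr_right fun hv => exists_congr fun x => and_congr_right fun hx => ?_
  exact graph_adj_congr (h _ ⟨x, hx, v, hv, rfl⟩)

theorem dependsOn_compl {ι : Type*} {S : Set (ι → Bool)} {I : Set ι}
    (h : DependsOn (· ∈ S) I) : DependsOn (· ∈ Sᶜ) I := fun x y hxy => by
  simpa using not_congr (iff_of_eq (h hxy))

section Probability

variable {β : ℝ} {hβ : 0 < β}

theorem law_inter {S T : Set (Config d N)} {I J : Set (Sym2 (Box d N))}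
    (hS : DependsOn (· ∈ S) I) (hT : DependsOn (· ∈ T) J) (hIJ : Disjoint I J) :
    (law d N β hβ).real (S ∩ T) = (law d N β hβ).real S * (law d N β hβ).real T :=
  measureReal_inter_of_dependsOn _ hS hT hIJ

/-- Revealing the edges from `X` to the sites outside `D ∪ X ∪ Y`. -/
theorem law_compl_conn_succ_le {D X Y : Finset (Box d N)} (hDX : Disjoint D X) (M k : ℕ) {q : ℝ}
    (hq0 : 0 ≤ q)
    (hq : ∀ X' : Finset (Box d N), Disjoint (D ∪ X ∪ Y) X' → X'.card = M →
      (law d N β hβ).real (conn (D ∪ X) X' Y k)ᶜ ≤ q) :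
    (law d N β hβ).real (conn D X Y (k + 1))ᶜ ≤
      (law d N β hβ).real {ω | (nbrs X (D ∪ X ∪ Y) ω).card < M} + q := by
  classical
  set P := law d N β hβ
  set Z := D ∪ X ∪ Y with hZ
  -- The new front is cut down to exactly `M` sites by a rule depending only on the neighbour set,
  -- so it is determined by the revealed edges. The value `∅` is a default for sets that are too
  -- small.
  have hsel : ∀ T : Finset (Box d N), ∃ S : Finset (Box d N), M ≤ T.card → S ⊆ T ∧ S.card = M := by
    intro T
    by_cases h : M ≤ T.card
    · obtain ⟨S, hS⟩ := Finset.exists_subset_card_eq h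
      exact ⟨S, fun _ => hS⟩
    · exact ⟨∅, fun h' => absurd h' h⟩
  choose g hg using hsel
  let F : Finset (Finset (Box d N)) := Finset.univ.filter fun X' => Disjoint Z X' ∧ X'.card = M
  let G : Config d N → Finset (Box d N) := fun ω => g (nbrs X Z ω)
  have hsub : (conn D X Y (k + 1))ᶜ ⊆ {ω | (nbrs X Z ω).card < M} ∪
      ⋃ X' ∈ F, (G ⁻¹' {X'} ∩ (conn (D ∪ X) X' Y k)ᶜ) := by
    intro ω hω
    by_cases hc : (nbrs X Z ω).card < M
    · exact Or.inl hc
    · right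
      obtain ⟨h1, h2⟩ := hg _ (not_lt.1 hc)
      simp only [Set.mem_iUnion]
      refine ⟨G ω, ?_, rfl, ?_⟩
      · simp only [F, Finset.mem_filter, Finset.mem_univ, true_and]
        refine ⟨Finset.disjoint_right.2 fun v hv => ?_, h2⟩
        have := h1 hv
        simp only [nbrs, Finset.mem_filter] at this
        exact this.2.1
      · rintro ⟨x', hx', y, hy, p, hp, hD⟩
        have := h1 hx'
        simp only [nbrs, Finset.mem_filter, Finset.mem_univ, true_and] at this
        obtain ⟨-, x, hx, hadj⟩ := this
        refine hω ⟨x, hx, y, hy, SimpleGraph.Walk.cons hadj p, by simpa using hp, ?_⟩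
        intro v hv
        rw [SimpleGraph.Walk.support_cons, List.mem_cons] at hv
        rcases hv with rfl | hv
        · exact Finset.disjoint_right.1 hDX hx
        · exact fun h => hD v hv (Finset.mem_union_left _ h)
  refine (measureReal_mono hsub).trans ((measureReal_union_le _ _).trans ?_)
  gcongr
  refine (measureReal_biUnion_finset_le _ _).trans ?_
  calc ∑ X' ∈ F, P.real (G ⁻¹' {X'} ∩ (conn (D ∪ X) X' Y k)ᶜ)
      ≤ ∑ X' ∈ F, P.real (G ⁻¹' {X'}) * q := by
        refine Finset.sum_le_sum fun X' hX' => ?_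
        simp only [F, Finset.mem_filter, Finset.mem_univ, true_and] at hX'
        -- Every revealed pair meets `X`, while the continuation only sees pairs avoiding `D ∪ X`.
        rw [law_inter (I := {e | ∃ x ∈ X, ∃ v ∉ Z, e = s(x, v)}) (J := {e | ∀ v ∈ e, v ∉ D ∪ X})]
        · exact mul_le_mul_of_nonneg_left (hq X' hX'.1 hX'.2) measureReal_nonneg
        · intro ω ω' h
          simp [G, dependsOn_nbrs X Z h]
        · exact dependsOn_compl (dependsOn_conn _ _ _ _)
        · rw [Set.disjoint_left]
          rintro e ⟨x, hx, v, hv, rfl⟩ h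
          exact h x (by simp) (by simp [hx])
    _ = P.real (G ⁻¹' F) * q := by
        rw [← Finset.sum_mul, sum_measureReal_preimage_singleton]
        exact fun y _ => (Set.toFinite _).measurableSet
    _ ≤ q := mul_le_of_le_one_left hq0 measureReal_le_one

/-- `j` rounds of exploration from `X`, each multiplying the size of the front by `m`. -/
theorem law_compl_conn_add_le {m s₀ z : ℕ} (hm : 2 ≤ m) {p : ℝ} (hp0 : 0 ≤ p)
    (hp : ∀ X Z : Finset (Box d N), X ⊆ Z → s₀ ≤ X.card → Z.card ≤ z →
      (law d N β hβ).real {ω | (nbrs X Z ω).card < X.card * m} ≤ p)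
    {Y : Finset (Box d N)} (c k j : ℕ) {q : ℝ} (hq0 : 0 ≤ q) (D X : Finset (Box d N))
    (hDX : Disjoint D X) (hDY : Disjoint D Y) (hXY : Disjoint X Y) (hX : s₀ ≤ X.card)
    (hD : D.card ≤ c + X.card) (hz : c + 2 * (X.card * m ^ j) + Y.card ≤ z)
    (hq : ∀ D' X' : Finset (Box d N), Disjoint D' X' → Disjoint D' Y → Disjoint X' Y →
      X'.card = X.card * m ^ j → D'.card ≤ c + X'.card →
      (law d N β hβ).real (conn D' X' Y k)ᶜ ≤ q) :
    (law d N β hβ).real (conn D X Y (k + j))ᶜ ≤ q + j * p := by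
  classical
  induction j generalizing D X with
  | zero => simpa using hq D X hDX hDY hXY (by simp) hD
  | succ j ih =>
    have h := law_compl_conn_succ_le (hβ := hβ) (Y := Y) hDX (X.card * m) (k + j) (q := q + j * p)
      (by positivity) fun X' hX' hc => ?_
    · have hcard : (D ∪ X ∪ Y).card ≤ z := by
        have h1 := Finset.card_union_le (D ∪ X) Y
        have h2 := Finset.card_union_le D X
        have h3 : X.card * 1 ≤ X.card * m ^ (j + 1) :=
          Nat.mul_le_mul_left _ (Nat.one_le_pow _ _ (by omega))
        omega
      have h' := hp X (D ∪ X ∪ Y) (fun v hv => by simp [hv]) hX hcard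
      rw [← add_assoc]
      push_cast
      linarith
    · rw [Finset.disjoint_union_left, Finset.disjoint_union_left] at hX'
      -- As m ≥ 2, the next front is at least twice the current one, so |D ∪ X| ≤ c + 2|X| ≤ c +
      -- |X'| and the bound on used sites persists.
      have hX2 : X.card * 2 ≤ X.card * m := Nat.mul_le_mul_left _ hm
      have e : X'.card * m ^ j = X.card * m ^ (j + 1) := by rw [hc, pow_succ]; ring
      refine ih (D ∪ X) X' ?_ ?_ ?_ ?_ ?_ ?_ ?_
      · exact Finset.disjoint_union_left.2 hX'.1
      · exact Finset.disjoint_union_left.2 ⟨hDY, hXY⟩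
      · exact hX'.2.symm
      · omega
      · have := Finset.card_union_le D X
        omega
      · rw [e]; exact hz
      · rw [e]; exact hq

theorem law_bit_false (e : Sym2 (Box d N)) :
    (law d N β hβ).real {ω | ω e = false} = 1 - (pairProb d N β hβ e : ℝ) := by
  have h : (law d N β hβ).map (Function.eval e) = bernoulliMeasure true false (pairProb d N β hβ e) :=
    (measurePreserving_eval (fun e => bernoulliMeasure true false (pairProb d N β hβ e)) e).map_eq
  have h2 : {ω : Config d N | ω e = false} = Function.eval e ⁻¹' ({false} : Set Bool) := by ext; simp
  rw [h2, ← map_measureReal_apply (measurable_pi_apply e) (measurableSet_singleton _), h,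
    bernoulliMeasure_real_apply_of_notMem_of_mem _ (by simp) (by simp) (by simp)]

theorem one_sub_pairProb (x y : Box d N) :
    1 - (pairProb d N β hβ s(x, y) : ℝ) = Real.exp (-(β / (l1Dist x y : ℝ) ^ d)) := by
  simp [pairProb, connProb]

theorem law_forall_bit_false (T : Finset (Sym2 (Box d N))) :
    (law d N β hβ).real {ω | ∀ e ∈ T, ω e = false} =
      ∏ e ∈ T, (1 - (pairProb d N β hβ e : ℝ)) := by
  classical
  have h := integral_prod_of_dependsOn
    (fun e => bernoulliMeasure true false (pairProb d N β hβ e)) T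
    (fun e => {ω : Config d N | ω e = false}.indicator 1) (fun e => {e}) (fun e _ x y h => by
      simp [Set.indicator_apply, h e rfl]) (fun e _ e' _ h => by simpa using h)
  simp only [integral_indicator_one (Set.toFinite _).measurableSet] at h
  change ∫ ω, _ ∂(law d N β hβ) = ∏ e ∈ T, (law d N β hβ).real _ at h
  simp only [law_bit_false] at h
  rw [← h, ← integral_indicator_one (Set.toFinite _).measurableSet]
  congr 1
  funext ω
  simp only [Set.indicator_apply, Set.mem_ofPred_eq, Pi.one_apply, Finset.prod_ite_zero,
    Finset.prod_const_one]

/-- Non-adjacency forces closed bits, and disjointness makes the pairs in `X ×ˢ Y` distinct as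
unordered pairs, so the probabilities multiply. -/
theorem law_not_adj_le {X Y : Finset (Box d N)} (hXY : Disjoint X Y) :
    (law d N β hβ).real {ω | ∀ x ∈ X, ∀ y ∈ Y, ¬ (graph ω).Adj x y} ≤
      Real.exp (-∑ y ∈ Y, ∑ x ∈ X, β / (l1Dist x y : ℝ) ^ d) := by
  classical
  have hinj : Set.InjOn (fun a : Box d N × Box d N => s(a.1, a.2)) (X ×ˢ Y : Finset _) := by
    rintro ⟨x, y⟩ h ⟨x', y'⟩ h' he
    simp only [Finset.coe_product, Set.mem_prod, Finset.mem_coe] at h h'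
    rcases Sym2.eq_iff.1 he with ⟨rfl, rfl⟩ | ⟨rfl, rfl⟩
    · rfl
    · exact absurd h.1 (Finset.disjoint_right.1 hXY h'.2)
  have hsub : {ω : Config d N | ∀ x ∈ X, ∀ y ∈ Y, ¬ (graph ω).Adj x y} ⊆
      {ω | ∀ e ∈ (X ×ˢ Y).image (fun a => s(a.1, a.2)), ω e = false} := by
    intro ω hω e he
    simp only [Finset.mem_image, Finset.mem_product] at he
    obtain ⟨⟨x, y⟩, ⟨hx, hy⟩, rfl⟩ := he
    have h1 := hω x hx y hy
    simp only [graph, not_or, not_and, Bool.not_eq_true] at h1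
    exact h1.2 fun h => Finset.disjoint_left.1 hXY hx (h ▸ hy)
  refine (measureReal_mono hsub).trans_eq ?_
  rw [law_forall_bit_false, Finset.prod_image hinj]
  simp only [one_sub_pairProb]
  rw [← Real.exp_sum, Finset.sum_neg_distrib, Finset.sum_product_right]

theorem law_compl_conn_one_le {D X Y : Finset (Box d N)} (hDX : Disjoint D X) (hDY : Disjoint D Y)
    (hXY : Disjoint X Y) :
    (law d N β hβ).real (conn D X Y 1)ᶜ ≤
      Real.exp (-∑ y ∈ Y, ∑ x ∈ X, β / (l1Dist x y : ℝ) ^ d) := by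
  refine (measureReal_mono fun ω hω => ?_).trans (law_not_adj_le hXY)
  intro x hx y hy hadj
  refine hω ⟨x, hx, y, hy, hadj.toWalk, by simp, ?_⟩
  intro v hv
  simp only [SimpleGraph.Adj.toWalk, SimpleGraph.Walk.support_cons, SimpleGraph.Walk.support_nil,
    List.mem_cons, List.not_mem_nil, or_false] at hv
  rcases hv with rfl | rfl
  · exact Finset.disjoint_right.1 hDX hx
  · exact Finset.disjoint_right.1 hDY hy

theorem l1Dist_pos {x y : Box d N} (h : x ≠ y) : 0 < l1Dist x y := by
  obtain ⟨i, hi⟩ := Function.ne_iff.1 h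
  refine Finset.sum_pos' (fun _ _ => Nat.zero_le _) ⟨i, Finset.mem_univ _, ?_⟩
  have : (x i : ℕ) ≠ y i := fun h => hi (Fin.ext h)
  omega

/-- For non-neighbours this is 1 - exp(-t) ≤ t; the extra 1 in β + 1 pays for the edges that are
always present. -/
theorem law_adj_le {x y : Box d N} (h : x ≠ y) :
    (law d N β hβ).real {ω | (graph ω).Adj x y} ≤ (β + 1) / (l1Dist x y : ℝ) ^ d := by
  have hpos : (0 : ℝ) < l1Dist x y := by exact_mod_cast l1Dist_pos h
  by_cases h1 : l1Dist x y = 1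
  · rw [h1]
    simpa using measureReal_le_one.trans (by linarith)
  · have hset : {ω : Config d N | (graph ω).Adj x y} = {ω | ω s(x, y) = false}ᶜ := by
      ext ω; simp [graph, h1, h]
    rw [hset, probReal_compl_eq_one_sub (Set.toFinite _).measurableSet, law_bit_false,
      one_sub_pairProb]
    have := Real.add_one_le_exp (-(β / (l1Dist x y : ℝ) ^ d))
    have h2 : β / (l1Dist x y : ℝ) ^ d ≤ (β + 1) / (l1Dist x y : ℝ) ^ d := by
      gcongr; linarith
    linarith

/-- The expected number of sites at distance at most `k` from a site, when the expected degrees are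
at most `Δ`. -/
theorem sum_law_conn_le {Δ : ℝ}
    (hΔ : ∀ x : Box d N, ∑ y ∈ Finset.univ.erase x, (law d N β hβ).real {ω | (graph ω).Adj x y} ≤ Δ)
    (hΔ0 : 0 ≤ Δ) (k : ℕ) (D : Finset (Box d N)) (x : Box d N) :
    ∑ y, (law d N β hβ).real (conn D {x} {y} k) ≤ (1 + Δ) ^ k := by
  classical
  set P := law d N β hβ
  have hdiag : ∑ y : Box d N, P.real {_ω | x = y} ≤ 1 := by
    rw [Finset.sum_eq_single x]
    · exact measureReal_le_one
    · intro y _ h; simp [h.symm]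
    · simp
  induction k generalizing D x with
  | zero =>
    rw [pow_zero]
    refine (Finset.sum_le_sum fun y _ => measureReal_mono ?_).trans hdiag
    rintro ω ⟨x', hx', y', hy', p, hp, -⟩
    rw [Finset.mem_singleton] at hx' hy'
    subst hx' hy'
    exact p.eq_of_length_eq_zero (by omega)
  | succ k ih =>
    have hsub : ∀ y, conn D {x} {y} (k + 1) ⊆ {_ω | x = y} ∪ ⋃ z ∈ Finset.univ.erase x,
        ({ω | (graph ω).Adj x z} ∩ conn (D ∪ {x}) {z} {y} k) := by
      rintro y ω ⟨x', hx', y', hy', p, hp, hD⟩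
      rw [Finset.mem_singleton] at hx' hy'
      subst hx' hy'
      -- On a path, the part after the first step never returns to its start, so it is independent
      -- of the first edge; enlarging `D` records this.
      have hp' := (p.length_bypass_le_length).trans hp
      have hD' : ∀ v ∈ p.bypass.support, v ∉ D := fun v hv => hD v (p.support_bypass_subset_support hv)
      have hpath := p.bypass_isPath
      generalize p.bypass = r at hp' hD' hpath
      cases r with
      | nil => exact Or.inl rfl
      | @cons _ z _ hadj r =>
        right
        simp only [Set.mem_iUnion]
        rw [SimpleGraph.Walk.cons_isPath_iff] at hpath
        refine ⟨z, by simpa using hadj.ne', hadj, z, by simp, y', by simp, r, by simpa using hp', ?_⟩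
        intro v hv
        simp only [Finset.mem_union, Finset.mem_singleton, not_or]
        refine ⟨hD' v (by simp [hv]), ?_⟩
        rintro rfl
        exact hpath.2 hv
    calc ∑ y, P.real (conn D {x} {y} (k + 1))
        ≤ ∑ y, (P.real {_ω | x = y} + ∑ z ∈ Finset.univ.erase x,
            P.real {ω | (graph ω).Adj x z} * P.real (conn (D ∪ {x}) {z} {y} k)) := by
          refine Finset.sum_le_sum fun y _ => (measureReal_mono (hsub y)).trans
            ((measureReal_union_le _ _).trans (add_le_add le_rfl
              ((measureReal_biUnion_finset_le _ _).trans (Finset.sum_le_sum fun z _ => ?_))))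
          rw [law_inter (I := {s(x, z)}) (J := {e | ∀ v ∈ e, v ∉ D ∪ {x}})]
          · intro ω ω' h
            exact propext (graph_adj_congr (h _ rfl))
          · exact dependsOn_conn _ _ _ _
          · rw [Set.disjoint_singleton_left]
            exact fun h => h x (by simp) (by simp)
      _ = ∑ y, P.real {_ω | x = y} + ∑ z ∈ Finset.univ.erase x,
            P.real {ω | (graph ω).Adj x z} * ∑ y, P.real (conn (D ∪ {x}) {z} {y} k) := by
          rw [Finset.sum_add_distrib, Finset.sum_comm]
          simp only [Finset.mul_sum]
      _ ≤ 1 + ∑ z ∈ Finset.univ.erase x, P.real {ω | (graph ω).Adj x z} * (1 + Δ) ^ k := by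
          refine add_le_add hdiag (Finset.sum_le_sum fun z _ =>
            mul_le_mul_of_nonneg_left (ih _ _ ?_) measureReal_nonneg)
          rw [Finset.sum_eq_single z]
          · exact measureReal_le_one
          · intro y _ h; simp [h.symm]
          · simp
      _ ≤ 1 + Δ * (1 + Δ) ^ k := by
          rw [← Finset.sum_mul]
          gcongr
          exact hΔ x
      _ ≤ (1 + Δ) ^ (k + 1) := by
          have : 1 ≤ (1 + Δ) ^ k := one_le_pow₀ (by linarith)
          rw [pow_succ]; nlinarith

end Probability

end LongRangePercolation

/-! ### Geometry of the box: dyadic sums, grid walks, segments. -/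

namespace LongRangePercolation

variable {d N : ℕ}

theorem natAbs_le_l1Dist (x y : Box d N) (i : Fin d) :
    ((x i : ℤ) - (y i : ℤ)).natAbs ≤ l1Dist x y :=
  Finset.single_le_sum (f := fun i => ((x i : ℤ) - (y i : ℤ)).natAbs) (fun _ _ => Nat.zero_le _)
    (Finset.mem_univ i)

theorem l1Dist_le_mul (x y : Box d N) {r : ℕ} (h : ∀ i, ((x i : ℤ) - (y i : ℤ)).natAbs ≤ r) :
    l1Dist x y ≤ d * r := by
  simpa [l1Dist] using Finset.sum_le_card_nsmul Finset.univ
    (fun i => ((x i : ℤ) - (y i : ℤ)).natAbs) r fun i _ => h i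

theorem l1Dist_le (x y : Box d N) : l1Dist x y ≤ d * N :=
  l1Dist_le_mul x y fun i => by have := (x i).2; have := (y i).2; omega

theorem card_filter_near_le (t : Fin (N + 1)) (r : ℕ) :
    (Finset.univ.filter fun u : Fin (N + 1) => ((t : ℤ) - u).natAbs < r).card ≤ 2 * r := by
  calc _ ≤ (Finset.Ioo ((t : ℤ) - r) (t + r)).card := by
        refine Finset.card_le_card_of_injOn (fun u => (u : ℤ)) (fun u hu => ?_) (fun u _ v _ h => ?_)
        · simp only [Finset.coe_filter, Finset.mem_univ, true_and, Set.mem_ofPred_eq] at hu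
          simp only [Finset.coe_Ioo, Set.mem_Ioo]
          omega
        · exact Fin.ext (by simpa using h)
    _ ≤ 2 * r := by simp; omega

theorem card_l1Dist_lt_le (x : Box d N) (r : ℕ) :
    (Finset.univ.filter fun y : Box d N => l1Dist x y < r).card ≤ (2 * r) ^ d := by
  calc _ ≤ (Fintype.piFinset fun i =>
        Finset.univ.filter fun u : Fin (N + 1) => ((x i : ℤ) - u).natAbs < r).card := by
        refine Finset.card_le_card fun y hy => ?_
        simp only [Finset.mem_filter, Finset.mem_univ, true_and] at hy
        simp only [Fintype.mem_piFinset, Finset.mem_filter, Finset.mem_univ, true_and]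
        exact fun i => (natAbs_le_l1Dist x y i).trans_lt hy
    _ ≤ (2 * r) ^ d := by
        rw [Fintype.card_piFinset]
        refine (Finset.prod_le_prod' fun i _ => card_filter_near_le (x i) r).trans ?_
        simp

/-- The dyadic annulus at scale 2^j has at most (4 · 2^j)^d sites, each contributing at most
2^{-jd}; distances up to d N leave only logarithmically many scales. -/
theorem sum_inv_l1Dist_pow_le (x : Box d N) :
    ∑ y ∈ Finset.univ.erase x, 1 / (l1Dist x y : ℝ) ^ d ≤ 4 ^ d * (Nat.log 2 (d * N) + 1) := by
  classical
  rw [← Finset.sum_fiberwise_of_maps_to (g := fun y => Nat.log 2 (l1Dist x y))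
    (t := Finset.range (Nat.log 2 (d * N) + 1))]
  · calc _ ≤ ∑ j ∈ Finset.range (Nat.log 2 (d * N) + 1), (4 : ℝ) ^ d := by
          refine Finset.sum_le_sum fun j _ => ?_
          have h1 : ∀ y ∈ (Finset.univ.erase x).filter (fun y => Nat.log 2 (l1Dist x y) = j),
              1 / (l1Dist x y : ℝ) ^ d ≤ 1 / ((2 : ℝ) ^ j) ^ d := by
            intro y hy
            simp only [Finset.mem_filter, Finset.mem_erase, Finset.mem_univ, and_true] at hy
            have h2 := Nat.pow_log_le_self 2 (l1Dist_pos hy.1.symm).ne'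
            rw [hy.2] at h2
            have h3 : (2 : ℝ) ^ j ≤ l1Dist x y := by exact_mod_cast h2
            gcongr
          refine (Finset.sum_le_card_nsmul _ _ _ h1).trans ?_
          have hcard : ((Finset.univ.erase x).filter
              (fun y => Nat.log 2 (l1Dist x y) = j)).card ≤ (2 * 2 ^ (j + 1)) ^ d := by
            refine (Finset.card_le_card fun y hy => ?_).trans (card_l1Dist_lt_le x (2 ^ (j + 1)))
            simp only [Finset.mem_filter, Finset.mem_erase, Finset.mem_univ, and_true] at hy
            simp only [Finset.mem_filter, Finset.mem_univ, true_and]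
            rw [← hy.2]
            exact Nat.lt_pow_succ_log_self one_lt_two _
          have hcard' : (((Finset.univ.erase x).filter
              (fun y => Nat.log 2 (l1Dist x y) = j)).card : ℝ) ≤ 4 ^ d * (2 ^ j) ^ d := by
            rw [← mul_pow]
            calc _ ≤ (((2 * 2 ^ (j + 1)) ^ d : ℕ) : ℝ) := by exact_mod_cast hcard
              _ = _ := by push_cast; congr 1; ring
          rw [nsmul_eq_mul, mul_one_div, div_le_iff₀ (by positivity)]
          exact hcard'
      _ = _ := by simp; ring
  · intro y _
    simp only [Finset.mem_range]
    exact Nat.lt_succ_of_le (Nat.log_mono_right (l1Dist_le x y))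

/-- The sites whose coordinates all differ from those of `x` by an amount in `(2^j, 2^(j+1)]`. -/
def shell (x : Box d N) (j : ℕ) : Finset (Box d N) :=
  Fintype.piFinset fun i =>
    Finset.univ.filter fun u : Fin (N + 1) => ((x i : ℤ) - u).natAbs ∈ Set.Ioc (2 ^ j) (2 ^ (j + 1))

theorem mem_shell {x v : Box d N} {j : ℕ} : v ∈ shell x j ↔
    ∀ i, 2 ^ j < ((x i : ℤ) - v i).natAbs ∧ ((x i : ℤ) - v i).natAbs ≤ 2 ^ (j + 1) := by
  simp [shell]

/-- From `t`, count towards the farther end of the interval, where there is room for 2r steps. -/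
theorem le_card_filter_Ioc (t : Fin (N + 1)) (r : ℕ) (hr : 4 * r ≤ N) :
    r ≤ (Finset.univ.filter fun u : Fin (N + 1) =>
      ((t : ℤ) - u).natAbs ∈ Set.Ioc r (2 * r)).card := by
  have ht := t.2
  by_cases h : 2 * (t : ℕ) ≤ N
  · calc r = (Finset.univ : Finset (Fin r)).card := by simp
      _ ≤ _ := by
        refine Finset.card_le_card_of_injOn (fun u => ⟨t + r + 1 + u, by omega⟩)
          (fun u _ => ?_) (fun u _ v _ h => ?_)
        · simp only [Finset.coe_filter, Finset.mem_univ, true_and, Set.mem_ofPred_eq, Set.mem_Ioc]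
          have := u.2
          push_cast
          omega
        · simp only [Fin.mk.injEq] at h
          exact Fin.ext (by omega)
  · calc r = (Finset.univ : Finset (Fin r)).card := by simp
      _ ≤ _ := by
        refine Finset.card_le_card_of_injOn (fun u => ⟨t - (r + 1 + u), by omega⟩)
          (fun u _ => ?_) (fun u _ v _ h => ?_)
        · simp only [Finset.coe_filter, Finset.mem_univ, true_and, Set.mem_ofPred_eq, Set.mem_Ioc]
          have := u.2
          omega
        · simp only [Fin.mk.injEq] at h
          exact Fin.ext (by omega)

theorem le_card_shell (x : Box d N) {j : ℕ} (hj : 2 ^ (j + 2) ≤ N) :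
    (2 ^ j) ^ d ≤ (shell x j).card := by
  rw [shell, Fintype.card_piFinset]
  calc (2 ^ j) ^ d = ∏ _i : Fin d, 2 ^ j := by simp
    _ ≤ _ := Finset.prod_le_prod' fun i _ => by
      have := le_card_filter_Ioc (x i) (2 ^ j) (by rw [pow_add] at hj; omega)
      rw [pow_succ, mul_comm (2 ^ j) 2]
      exact this

theorem disjoint_shell (hd : 1 ≤ d) (x : Box d N) {i j : ℕ} (h : i ≠ j) :
    Disjoint (shell x i) (shell x j) := by
  wlog hij : i < j generalizing i j
  · exact (this h.symm (by omega)).symm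
  rw [Finset.disjoint_left]
  intro v hi hj
  have h1 := mem_shell.1 hi ⟨0, hd⟩
  have h2 := mem_shell.1 hj ⟨0, hd⟩
  have h3 : 2 ^ (i + 1) ≤ 2 ^ j := Nat.pow_le_pow_right (by norm_num) hij
  omega

/-- Each of the `J` shells from scale `a` on has at least 2^{jd} sites, at least half of that number
survives the removal of `Z`, and all lie within distance d 2^{j+1}. So each shell contributes a
constant. -/
theorem le_sum_inv_l1Dist_pow (hd : 1 ≤ d) (x : Box d N) (Z : Finset (Box d N)) {a J : ℕ}
    (hN : 2 ^ (a + J + 1) ≤ N) (hZ : 2 * Z.card ≤ (2 ^ a) ^ d) :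
    (J : ℝ) / (2 * (2 * d) ^ d) ≤
      ∑ v ∈ Finset.univ.filter (fun v => v ∉ Z ∧ 2 ^ a ≤ l1Dist x v),
        1 / (l1Dist x v : ℝ) ^ d := by
  classical
  have hd0 : (0 : ℝ) < d := by exact_mod_cast hd
  have hle : ∀ j ∈ Finset.Ico a (a + J), ∀ v ∈ shell x j, 2 ^ a ≤ l1Dist x v := by
    intro j hj v hv
    have h1 := mem_shell.1 hv ⟨0, hd⟩
    have h2 := natAbs_le_l1Dist x v ⟨0, hd⟩
    have h3 : 2 ^ a ≤ 2 ^ j := Nat.pow_le_pow_right (by norm_num) (Finset.mem_Ico.1 hj).1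
    omega
  calc (J : ℝ) / (2 * (2 * d) ^ d) = ∑ j ∈ Finset.Ico a (a + J), 1 / (2 * (2 * (d : ℝ)) ^ d) := by
        simp; ring
    _ ≤ ∑ j ∈ Finset.Ico a (a + J), ∑ v ∈ shell x j \ Z, 1 / (l1Dist x v : ℝ) ^ d := by
        refine Finset.sum_le_sum fun j hj => ?_
        have hj' := Finset.mem_Ico.1 hj
        have h1 : ∀ v ∈ shell x j \ Z,
            1 / ((2 * (d : ℝ)) ^ d * (2 ^ j) ^ d) ≤ 1 / (l1Dist x v : ℝ) ^ d := by
          intro v hv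
          have hv := (Finset.mem_sdiff.1 hv).1
          have h2 := l1Dist_le_mul x v fun i => (mem_shell.1 hv i).2
          have h3 : (l1Dist x v : ℝ) ≤ 2 * d * 2 ^ j := by
            calc (l1Dist x v : ℝ) ≤ ((d * 2 ^ (j + 1) : ℕ) : ℝ) := by exact_mod_cast h2
              _ = _ := by push_cast; ring
          have h4 : (0 : ℝ) < l1Dist x v := by
            have := hle j hj v hv
            have h5 : 0 < 2 ^ a := by positivity
            exact_mod_cast lt_of_lt_of_le h5 this
          rw [← mul_pow]
          gcongr
        refine le_trans ?_ (Finset.card_nsmul_le_sum _ _ _ h1)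
        have hcard : (2 ^ j) ^ d ≤ 2 * (shell x j \ Z).card := by
          have h2 := le_card_shell x (j := j)
            ((Nat.pow_le_pow_right (by norm_num) (by omega)).trans hN)
          have h3 := Finset.le_card_sdiff Z (shell x j)
          have h4 : (2 ^ a) ^ d ≤ (2 ^ j) ^ d :=
            Nat.pow_le_pow_left (Nat.pow_le_pow_right (by norm_num) hj'.1) _
          omega
        have hcard' : ((2 : ℝ) ^ j) ^ d ≤ 2 * (shell x j \ Z).card := by exact_mod_cast hcard
        rw [nsmul_eq_mul, mul_one_div, div_le_div_iff₀ (by positivity) (by positivity)]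
        have : (0 : ℝ) < (2 * d) ^ d := by positivity
        nlinarith
    _ = ∑ v ∈ (Finset.Ico a (a + J)).biUnion (fun j => shell x j \ Z),
          1 / (l1Dist x v : ℝ) ^ d := by
        rw [Finset.sum_biUnion]
        exact fun i _ j _ h => (disjoint_shell hd x h).mono Finset.sdiff_subset Finset.sdiff_subset
    _ ≤ _ := by
        refine Finset.sum_le_sum_of_subset_of_nonneg (fun v hv => ?_) fun v _ _ => by positivity
        simp only [Finset.mem_biUnion, Finset.mem_sdiff] at hv
        obtain ⟨j, hj, hv, hvZ⟩ := hv
        simp only [Finset.mem_filter, Finset.mem_univ, true_and]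
        exact ⟨hvZ, hle j hj v hv⟩

/-- Nearest-neighbour edges are always present: move one coordinate a unit towards its target and
induct. -/
theorem exists_walk_length_eq (ω : Config d N) (x y : Box d N) :
    ∃ p : (graph ω).Walk x y, p.length = l1Dist x y := by
  induction hn : l1Dist x y generalizing x with
  | zero =>
    by_cases h : x = y
    · subst h; exact ⟨.nil, rfl⟩
    · exact absurd hn (l1Dist_pos h).ne'
  | succ n ih =>
    have hxy : x ≠ y := by rintro rfl; simp [l1Dist_self] at hn
    obtain ⟨i, hi⟩ := Function.ne_iff.1 hxy
    have hi' : (x i : ℕ) ≠ y i := fun h => hi (Fin.ext h)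
    obtain ⟨t, ht1, ht2⟩ : ∃ t : Fin (N + 1), ((x i : ℤ) - t).natAbs = 1 ∧
        ((t : ℤ) - y i).natAbs + 1 = ((x i : ℤ) - y i).natAbs := by
      have := (x i).2
      have := (y i).2
      rcases lt_or_gt_of_ne hi' with h | h
      · exact ⟨⟨x i + 1, by omega⟩, by push_cast; omega, by push_cast; omega⟩
      · exact ⟨⟨x i - 1, by omega⟩, by simp only; omega, by simp only; omega⟩
    have h1 : l1Dist x (Function.update x i t) = 1 := by
      rw [l1Dist, Finset.sum_eq_single i]
      · simpa using ht1
      · intro j _ hj; simp [hj]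
      · simp
    have h2 : l1Dist (Function.update x i t) y + 1 = l1Dist x y := by
      rw [l1Dist, l1Dist, ← Finset.add_sum_erase _ _ (Finset.mem_univ i),
        ← Finset.add_sum_erase (a := i) Finset.univ (fun i => ((x i : ℤ) - (y i : ℤ)).natAbs)
          (Finset.mem_univ i)]
      have h3 : ∑ j ∈ Finset.univ.erase i, (((Function.update x i t) j : ℤ) - (y j : ℤ)).natAbs =
          ∑ j ∈ Finset.univ.erase i, ((x j : ℤ) - (y j : ℤ)).natAbs :=
        Finset.sum_congr rfl fun j hj => by simp [Finset.ne_of_mem_erase hj]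
      rw [h3]
      simp only [Function.update_self]
      omega
    obtain ⟨p, hp⟩ := ih (Function.update x i t) (by omega)
    have hadj : (graph ω).Adj x (Function.update x i t) := Or.inl h1
    exact ⟨.cons hadj p, by simp [hp]⟩

theorem exists_finset_near (hd : 1 ≤ d) {s : ℕ} (hs : s ≤ N) (x : Box d N) :
    ∃ B : Finset (Box d N), B.card = s ∧ ∀ v ∈ B, l1Dist x v ≤ s := by
  let i : Fin d := ⟨0, hd⟩
  have hx := (x i).2
  -- The segment starts at the `i`-th coordinate of `x`, shifted back when necessary to fit in the
  -- box.
  let a : ℕ := min (x i) (N - s)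
  have ha1 : a ≤ x i := min_le_left _ _
  have ha2 : a + s ≤ N := by have := min_le_right (x i : ℕ) (N - s); omega
  have ha3 : (x i : ℕ) ≤ a + s := by
    rcases min_choice (x i : ℕ) (N - s) with h | h <;> simp only [a, h] <;> omega
  let f : Fin s → Box d N := fun u => Function.update x i ⟨a + u, by omega⟩
  have hf : Function.Injective f := fun u v h => by
    have := congrFun h i
    simp only [f, Function.update_self, Fin.mk.injEq] at this
    exact Fin.ext (by omega)
  refine ⟨Finset.univ.map ⟨f, hf⟩, by simp, ?_⟩
  intro v hv
  simp only [Finset.mem_map, Finset.mem_univ, true_and, Function.Embedding.coeFn_mk] at hv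
  obtain ⟨u, rfl⟩ := hv
  have hu := u.2
  rw [l1Dist, Finset.sum_eq_single i]
  · simp only [f, Function.update_self]
    push_cast
    omega
  · intro j _ hj; simp [f, hj]
  · simp

/-! ### Growth of fronts and finite-volume bounds on the diameter. -/

section Probability

variable {β : ℝ} {hβ : 0 < β}

theorem exp_neg_le_one_sub_half {t : ℝ} (h0 : 0 ≤ t) (h1 : t ≤ 1) :
    Real.exp (-t) ≤ 1 - t / 2 := by
  rw [Real.exp_neg, inv_le_comm₀ (Real.exp_pos _) (by linarith)]
  refine le_trans ?_ (Real.add_one_le_exp t)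
  rw [inv_le_iff_one_le_mul₀ (by linarith)]
  nlinarith

/-- With high probability a set `X` has at least `m * |X|` neighbours outside `Z`. -/
theorem law_card_nbrs_lt_le (hd : 1 ≤ d) {a J m : ℕ} (hN : 2 ^ (a + J + 1) ≤ N)
    (hm : 16 * (2 * d) ^ d * m ≤ β * J) {X Z : Finset (Box d N)} (hXZ : X ⊆ Z)
    (hZ : 2 * Z.card ≤ (2 ^ a) ^ d) (hX : β * X.card ≤ (2 ^ a) ^ d) :
    (law d N β hβ).real {ω | (nbrs X Z ω).card < X.card * m} ≤ Real.exp (-(X.card * m)) := by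
  classical
  -- Discarding sites closer than 2^a keeps the total rate `lam v` at most 1, where 1 - exp(-lam) ≥
  -- lam / 2.
  let far : Box d N → Finset (Box d N) := fun v => X.filter fun x => 2 ^ a ≤ l1Dist x v
  let lam : Box d N → ℝ := fun v => ∑ x ∈ far v, β / (l1Dist x v : ℝ) ^ d
  have hterm : ∀ x v : Box d N, 2 ^ a ≤ l1Dist x v →
      β / (l1Dist x v : ℝ) ^ d ≤ β / ((2 : ℝ) ^ a) ^ d := by
    intro x v h
    have : (2 : ℝ) ^ a ≤ l1Dist x v := by exact_mod_cast h
    gcongr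
  have hlam0 : ∀ v, 0 ≤ lam v := fun v => Finset.sum_nonneg fun x _ => by positivity
  have hlam1 : ∀ v, lam v ≤ 1 := by
    intro v
    refine (Finset.sum_le_card_nsmul _ _ _ fun x hx => hterm x v (Finset.mem_filter.1 hx).2).trans ?_
    have : ((far v).card : ℝ) ≤ X.card := by exact_mod_cast Finset.card_filter_le _ _
    rw [nsmul_eq_mul, mul_div_assoc', div_le_one (by positivity)]
    nlinarith
  have hch := measureReal_card_lt_le
    (fun e => bernoulliMeasure true false (pairProb d N β hβ e)) (Finset.univ.filter (· ∉ Z))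
    (fun v => {ω : Config d N | ∃ x ∈ X, (graph ω).Adj x v}) (fun v => {e | ∃ x ∈ X, e = s(x, v)})
    (fun v _ ω ω' h => propext <| exists_congr fun x => and_congr_right fun hx =>
      graph_adj_congr (h _ ⟨x, hx, rfl⟩)) ?_ (fun v => lam v / 2) ?_
    (fun v _ => by have := hlam0 v; positivity) (X.card * m)
  · have hset : {ω : Config d N | (nbrs X Z ω).card < X.card * m} =
        {ω | ((Finset.univ.filter (· ∉ Z)).filter
          fun v => ω ∈ {ω : Config d N | ∃ x ∈ X, (graph ω).Adj x v}).card < X.card * m} := by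
      ext ω
      simp only [nbrs, Finset.filter_filter, Set.mem_ofPred_eq]
    rw [hset]
    refine hch.trans (Real.exp_le_exp.2 ?_)
    have hsum : (X.card : ℝ) * (β * (J / (2 * (2 * d) ^ d))) ≤
        ∑ v ∈ Finset.univ.filter (· ∉ Z), lam v := by
      calc (X.card : ℝ) * (β * (J / (2 * (2 * d) ^ d)))
          ≤ ∑ x ∈ X, β * ∑ v ∈ Finset.univ.filter (fun v => v ∉ Z ∧ 2 ^ a ≤ l1Dist x v),
              1 / (l1Dist x v : ℝ) ^ d := by
            rw [← nsmul_eq_mul]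
            exact Finset.card_nsmul_le_sum _ _ _ fun x _ =>
              mul_le_mul_of_nonneg_left (le_sum_inv_l1Dist_pow hd x Z hN hZ) hβ.le
        _ = _ := by
            simp only [lam, far, Finset.mul_sum, Finset.sum_filter]
            rw [Finset.sum_comm]
            refine Finset.sum_congr rfl fun v _ => ?_
            by_cases hv : v ∈ Z <;> simp [hv, div_eq_mul_inv]
    rw [← Finset.sum_div]
    have hd0 : (0 : ℝ) < (2 * d) ^ d := by
      have : (0 : ℝ) < d := by exact_mod_cast hd
      positivity
    -- The rates sum to at least 8 m |X|, so the lower bounds lam / 2 sum to 4 m |X|, and Chernoff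
    -- yields exp(m|X| - 2 m|X|).
    have h8 : 8 * (m : ℝ) ≤ β * (J / (2 * (2 * d) ^ d)) := by
      rw [mul_div_assoc', le_div_iff₀ (by positivity)]
      linarith
    have := mul_le_mul_of_nonneg_left h8 (Nat.cast_nonneg (α := ℝ) X.card)
    push_cast
    linarith
  · intro v hv v' hv' hne
    simp only [Finset.coe_filter, Finset.mem_univ, true_and, Set.mem_ofPred_eq] at hv hv'
    rw [Function.onFun, Set.disjoint_left]
    rintro e ⟨x, hx, rfl⟩ ⟨x', hx', he⟩
    rcases Sym2.eq_iff.1 he with ⟨-, h⟩ | ⟨h, -⟩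
    · exact hne h
    · exact hv' (hXZ (h ▸ hx))
  · intro v hv
    simp only [Finset.mem_filter, Finset.mem_univ, true_and] at hv
    have hdisj : Disjoint (far v) {v} := by
      rw [Finset.disjoint_singleton_right]
      exact fun h => hv (hXZ (Finset.mem_filter.1 h).1)
    have h1 := law_not_adj_le (hβ := hβ) hdisj
    rw [Finset.sum_singleton] at h1
    have h2 : {ω : Config d N | ∃ x ∈ X, (graph ω).Adj x v}ᶜ ⊆
        {ω | ∀ x ∈ far v, ∀ y ∈ ({v} : Finset (Box d N)), ¬ (graph ω).Adj x y} := by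
      intro ω hω x hx y hy hadj
      rw [Finset.mem_singleton] at hy
      subst hy
      exact hω ⟨x, (Finset.mem_filter.1 hx).1, hadj⟩
    have h3 := (measureReal_mono (μ := law d N β hβ) h2).trans h1
    rw [probReal_compl_eq_one_sub (Set.toFinite _).measurableSet] at h3
    have h4 := exp_neg_le_one_sub_half (hlam0 v) (hlam1 v)
    change _ ≤ (law d N β hβ).real _
    linarith

/-- A segment near each endpoint costs at most `s` steps, the two explorations `k` rounds each, and
the joining edge one step. The two terms bound the failure of a round and of the joining edge. -/
theorem law_lt_dist_le (hd : 1 ≤ d) {a J m s k : ℕ} (hN : 2 ^ (a + J + 1) ≤ N)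
    (hm : 16 * (2 * d) ^ d * m ≤ β * J) (hm2 : 2 ≤ m) (hs : s ≤ N)
    (hW : 8 * (s * m ^ k) ≤ (2 ^ a) ^ d) (hWβ : β * (4 * (s * m ^ k)) ≤ (2 ^ a) ^ d)
    (x y : Box d N) :
    (law d N β hβ).real {ω | 2 * s + 2 * k + 1 < (graph ω).dist x y} ≤
      2 * k * Real.exp (-(s * m)) + Real.exp (-(β * (s * m ^ k) ^ 2 / (d * N) ^ d)) := by
  classical
  obtain ⟨X, hXc, hX⟩ := exists_finset_near hd hs x
  obtain ⟨Y, hYc, hY⟩ := exists_finset_near hd hs y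
  have hdist : ∀ (ω : Config d N) {v w}, v ∈ X → w ∈ Y → ∀ p : (graph ω).Walk v w,
      (graph ω).dist x y ≤ 2 * s + p.length := by
    intro ω v w hv hw p
    obtain ⟨p1, h1⟩ := exists_walk_length_eq ω x v
    obtain ⟨p2, h2⟩ := exists_walk_length_eq ω w y
    have h3 := SimpleGraph.dist_le ((p1.append p).append p2)
    have h4 := hX v hv
    have h5 := hY w hw
    rw [l1Dist_comm] at h5
    simp only [SimpleGraph.Walk.length_append] at h3
    omega
  -- Intersecting segments already give distance at most 2s.
  by_cases hXY : Disjoint X Y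
  swap
  · obtain ⟨v, hvX, hvY⟩ := Finset.not_disjoint_iff.1 hXY
    have : {ω : Config d N | 2 * s + 2 * k + 1 < (graph ω).dist x y} = ∅ := by
      ext ω
      have := hdist ω hvX hvY .nil
      simp only [SimpleGraph.Walk.length_nil] at this
      simp only [Set.mem_ofPred_eq, Set.mem_empty_iff_false, iff_false]
      omega
    rw [this, measureReal_empty]
    positivity
  have hsub : {ω : Config d N | 2 * s + 2 * k + 1 < (graph ω).dist x y} ⊆
      (conn ∅ X Y (1 + k + k))ᶜ := by
    rintro ω hω ⟨v, hv, w, hw, p, hp, -⟩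
    have := hdist ω hv hw p
    simp only [Set.mem_ofPred_eq] at hω
    omega
  refine (measureReal_mono hsub).trans ?_
  set p := Real.exp (-((s : ℝ) * m)) with hp
  set q := Real.exp (-(β * ((s : ℝ) * m ^ k) ^ 2 / (d * N) ^ d)) with hq
  have hexp : ∀ X Z : Finset (Box d N), X ⊆ Z → s ≤ X.card → Z.card ≤ 4 * (s * m ^ k) →
      (law d N β hβ).real {ω | (nbrs X Z ω).card < X.card * m} ≤ p := by
    intro X Z hXZ hs hZ
    refine (law_card_nbrs_lt_le hd hN hm hXZ (by omega) (le_trans ?_ hWβ)).trans ?_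
    · have h1 : X.card ≤ 4 * (s * m ^ k) := (Finset.card_le_card hXZ).trans hZ
      have h2 : (X.card : ℝ) ≤ 4 * (s * m ^ k) := by exact_mod_cast h1
      gcongr
    · rw [hp, Real.exp_le_exp]
      have : (s : ℝ) ≤ X.card := by exact_mod_cast hs
      gcongr
  have hsm : s ≤ s * m ^ k := Nat.le_mul_of_pos_right _ (by positivity)
  have hmain : (law d N β hβ).real (conn ∅ X Y (1 + k + k))ᶜ ≤ (q + k * p) + k * p := by
    refine law_compl_conn_add_le hm2 (by positivity) hexp 0 (1 + k) k (by positivity) ∅ X (by simp)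
      (by simp) hXY hXc.ge (by simp) (by rw [hXc, hYc]; omega) ?_
    intro D X' hDX hDY hXY' hXc' hDc
    rw [hXc] at hXc'
    rw [conn_comm]
    -- Now `Y` explores with the front `X'` as target. The sites used before number at most |X'|,
    -- hence c = |X'|, and the budget is W + 2W + W = 4W for W = s m^k.
    refine law_compl_conn_add_le hm2 (by positivity) hexp X'.card 1 k (by positivity) D Y hDY
      hDX hXY'.symm hYc.ge (by omega) (by rw [hYc, hXc']; omega) ?_
    intro D' Y' hDY' hDX' hYX' hYc' _
    rw [hYc] at hYc'
    refine (law_compl_conn_one_le hDY' hDX' hYX').trans (Real.exp_le_exp.2 (neg_le_neg ?_))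
    have hge : ∀ v ∈ X', ∀ w ∈ Y', β / ((d : ℝ) * N) ^ d ≤ β / (l1Dist w v : ℝ) ^ d := by
      intro v hv w hw
      have h1 : (0 : ℝ) < l1Dist w v := by
        exact_mod_cast l1Dist_pos fun h : w = v => Finset.disjoint_left.1 hYX' hw (h ▸ hv)
      have h2 : (l1Dist w v : ℝ) ≤ d * N := by exact_mod_cast l1Dist_le w v
      gcongr
    calc β * ((s : ℝ) * m ^ k) ^ 2 / (d * N) ^ d
        = ∑ v ∈ X', ∑ w ∈ Y', β / ((d : ℝ) * N) ^ d := by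
          simp only [Finset.sum_const, nsmul_eq_mul, hXc', hYc']
          push_cast
          ring
      _ ≤ _ := Finset.sum_le_sum fun v hv => Finset.sum_le_sum fun w hw => hge v hv w hw
  linarith

theorem graph_preconnected (ω : Config d N) : (graph ω).Preconnected := fun x y =>
  ⟨(exists_walk_length_eq ω x y).choose⟩

theorem graph_connected (ω : Config d N) : (graph ω).Connected :=
  ⟨graph_preconnected ω⟩

/-- An upper bound for the probability that the diameter is large. -/
theorem law_lt_diameter_le (hd : 1 ≤ d) {a J m s k : ℕ} (hN : 2 ^ (a + J + 1) ≤ N)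
    (hm : 16 * (2 * d) ^ d * m ≤ β * J) (hm2 : 2 ≤ m) (hs : s ≤ N)
    (hW : 8 * (s * m ^ k) ≤ (2 ^ a) ^ d) (hWβ : β * (4 * (s * m ^ k)) ≤ (2 ^ a) ^ d) :
    (law d N β hβ).real {ω | 2 * s + 2 * k + 1 < diameter ω} ≤
      ((N : ℝ) + 1) ^ (2 * d) *
      (2 * k * Real.exp (-(s * m)) + Real.exp (-(β * (s * m ^ k) ^ 2 / (d * N) ^ d))) := by
  classical
  have hsub : {ω : Config d N | 2 * s + 2 * k + 1 < diameter ω} ⊆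
      ⋃ a ∈ (Finset.univ : Finset (Box d N × Box d N)),
        {ω | 2 * s + 2 * k + 1 < (graph ω).dist a.1 a.2} := by
    intro ω hω
    obtain ⟨x, y, hxy⟩ := (graph ω).exists_dist_eq_diam
    simp only [Set.mem_iUnion]
    refine ⟨(x, y), Finset.mem_univ _, ?_⟩
    simpa [diameter, ← hxy] using hω
  refine (measureReal_mono hsub (measure_ne_top _ _)).trans
    ((measureReal_biUnion_finset_le _ _).trans ?_)
  refine (Finset.sum_le_card_nsmul _ _ _ fun a _ =>
    law_lt_dist_le hd hN hm hm2 hs hW hWβ a.1 a.2).trans_eq ?_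
  rw [nsmul_eq_mul]
  congr 1
  simp [two_mul, pow_add]

/-- An upper bound for the probability that the diameter is small. -/
theorem law_diameter_le_le (hβ : 0 < β) (K : ℕ) :
    (law d N β hβ).real {ω | diameter ω ≤ K} ≤
      (1 + (β + 1) * (4 ^ d * (Nat.log 2 (d * N) + 1))) ^ K / ((N : ℝ) + 1) ^ d := by
  have hsum := sum_law_conn_le (hβ := hβ) (N := N) (d := d)
    (Δ := (β + 1) * (4 ^ d * (Nat.log 2 (d * N) + 1))) (fun x => ?_) (by positivity) K ∅ 0
  · rw [le_div_iff₀ (by positivity), mul_comm]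
    refine le_trans ?_ hsum
    -- A small diameter connects every site to 0, so each of the (N + 1)^d summands is at least this
    -- probability.
    have h : ∀ y ∈ (Finset.univ : Finset (Box d N)),
        (law d N β hβ).real {ω | diameter ω ≤ K} ≤ (law d N β hβ).real (conn ∅ {0} {y} K) := by
      refine fun y _ => measureReal_mono fun ω hω => ?_
      obtain ⟨p, hp⟩ := (graph_connected ω).exists_walk_length_eq_dist 0 y
      refine ⟨0, by simp, y, by simp, p, ?_, by simp⟩
      rw [hp]
      exact (SimpleGraph.dist_le_diam
        (SimpleGraph.connected_iff_ediam_ne_top.1 (graph_connected ω))).trans hω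
    refine le_trans (le_of_eq ?_) (Finset.card_nsmul_le_sum _ _ _ h)
    simp
  · calc _ ≤ ∑ y ∈ Finset.univ.erase x, (β + 1) * (1 / (l1Dist x y : ℝ) ^ d) :=
          Finset.sum_le_sum fun y hy => by
            rw [mul_one_div]
            exact law_adj_le (Finset.ne_of_mem_erase hy).symm
      _ ≤ _ := by
          rw [← Finset.mul_sum]
          exact mul_le_mul_of_nonneg_left (sum_inv_l1Dist_pow_le x) (by linarith)

end Probability

end LongRangePercolation

/-! ### Asymptotic choice of the exploration parameters. -/

namespace LongRangePercolation

theorem tendsto_log_div_self : Tendsto (fun L : ℝ => Real.log L / L) atTop (𝓝 0) := by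
  simpa using Real.tendsto_pow_log_div_mul_add_atTop 1 0 1 one_ne_zero

theorem tendsto_self_div_log : Tendsto (fun L : ℝ => L / Real.log L) atTop atTop := by
  have h : Tendsto (fun L : ℝ => Real.log L / L) atTop (𝓝[>] 0) := by
    rw [tendsto_nhdsWithin_iff]
    refine ⟨tendsto_log_div_self, ?_⟩
    filter_upwards [eventually_gt_atTop 1] with L hL
    have := Real.log_pos hL
    simp only [Set.mem_Ioi]
    positivity
  refine (tendsto_inv_nhdsGT_zero.comp h).congr fun L => ?_
  simp

theorem eventually_mul_pow_le_exp (C : ℝ) (n : ℕ) {b : ℝ} (hb : 0 < b) :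
    ∀ᶠ L : ℝ in atTop, C * L ^ n ≤ Real.exp (b * L) := by
  have h := (isLittleO_pow_exp_pos_mul_atTop n hb).const_mul_left C
  filter_upwards [h.bound one_pos] with L hL
  simpa using (le_abs_self _).trans hL

/-- The quotient of `log L` and `log ⌊c L⌋` tends to one. -/
theorem tendsto_log_div_log_floor {c : ℝ} (hc : 0 < c) :
    Tendsto (fun L : ℝ => Real.log L / Real.log (⌊c * L⌋₊ : ℝ)) atTop (𝓝 1) := by
  have h1 : Tendsto (fun L : ℝ => Real.log (⌊c * L⌋₊ / L) / Real.log L) atTop (𝓝 0) := by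
    have h2 : Tendsto (fun L : ℝ => (⌊c * L⌋₊ : ℝ) / L) atTop (𝓝 c) :=
      tendsto_nat_floor_mul_div_atTop hc.le
    exact (h2.log hc.ne').div_atTop Real.tendsto_log_atTop
  have h3 : Tendsto (fun L : ℝ => (1 + Real.log (⌊c * L⌋₊ / L) / Real.log L)⁻¹) atTop (𝓝 1) := by
    simpa using (h1.const_add 1).inv₀ (by simp)
  refine h3.congr' ?_
  filter_upwards [eventually_gt_atTop 1, eventually_ge_atTop (1 / c)] with L hL hL2
  have h4 : 0 < ⌊c * L⌋₊ := Nat.floor_pos.2 (by rw [div_le_iff₀ hc] at hL2; linarith)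
  have h5 : (0 : ℝ) < ⌊c * L⌋₊ := by exact_mod_cast h4
  have := Real.log_pos hL
  rw [Real.log_div h5.ne' (by positivity)]
  rw [← inv_div]
  field_simp
  ring

/-- The growth factor, the initial size and the number of rounds of the exploration. -/
theorem exists_exploration_parameters {d : ℕ} (hd : 1 ≤ d) {ε c : ℝ} (hε : 0 < ε) (hc : 0 < c)
    (C : ℝ) :
    ∃ c₂ : ℝ, 0 < c₂ ∧ ∀ᶠ L : ℝ in atTop, ∃ m s k : ℕ, 2 ≤ m ∧ m ≤ c * L ∧ s ≤ L ∧
      Real.exp (d * L / 2) * L ≤ s * m ^ k ∧ C * (s * m ^ k) ≤ Real.exp (3 / 4 * d * L) ∧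
      2 * s + 2 * k + 1 ≤ (1 + ε) * d * L / Real.log L ∧ 2 * k ≤ Real.exp L ∧
      c₂ * (L * (L / Real.log L)) ≤ s * m := by
  have hd0 : (0 : ℝ) < d := by exact_mod_cast hd
  set e := ε * d / 8 with he
  have he0 : 0 < e := by positivity
  refine ⟨e * (c / 2), by positivity, ?_⟩
  -- The path length in units of L / log L tends to 2e + d = (1 + ε/4) d. The 5 collects the
  -- additive 1 and twice the rounding of `s` and of `k`.
  have hsteps : ∀ᶠ L : ℝ in atTop, 2 * e + 5 * (Real.log L / L) +
      (d + 2 * (Real.log L / L)) * (Real.log L / Real.log (⌊c * L⌋₊ : ℝ)) < (1 + ε) * d := by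
    have h1 : Tendsto (fun L : ℝ => 2 * e + 5 * (Real.log L / L) +
      (d + 2 * (Real.log L / L)) * (Real.log L / Real.log (⌊c * L⌋₊ : ℝ))) atTop
        (𝓝 (2 * e + 5 * 0 + (d + 2 * 0) * 1)) :=
      ((tendsto_log_div_self.const_mul 5).const_add _).add
        (((tendsto_log_div_self.const_mul 2).const_add _).mul (tendsto_log_div_log_floor hc))
    refine h1.eventually_lt_const ?_
    rw [he]
    nlinarith [mul_pos hε hd0]
  filter_upwards [hsteps, eventually_gt_atTop (Real.exp 1), eventually_ge_atTop (2 / c),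
    Real.tendsto_log_atTop.eventually_ge_atTop ((1 + ε) * d),
    tendsto_self_div_log.eventually_ge_atTop (1 / e),
    Real.tendsto_log_atTop.eventually_ge_atTop (2 * e),
    eventually_mul_pow_le_exp (|C| * c) 3 (show (0 : ℝ) < d / 4 by positivity)]
    with L hL1 hLe hLc hL4 hL5 hL6 hL7
  have hL0 : 0 < L := (Real.exp_pos 1).trans hLe
  have hL1' : 2 < L := by
    have := Real.add_one_le_exp (1 : ℝ)
    linarith
  have hlog : 1 < Real.log L := (Real.lt_log_iff_exp_lt hL0).2 hLe
  set m := ⌊c * L⌋₊ with hm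
  set s := ⌈e * (L / Real.log L)⌉₊ with hs
  set k := ⌈(d * L / 2 + Real.log L) / Real.log m⌉₊ with hk
  have hcL : 2 ≤ c * L := by rw [div_le_iff₀ hc] at hLc; linarith
  have hm2 : 2 ≤ m := Nat.le_floor (by exact_mod_cast hcL)
  have hm2' : (2 : ℝ) ≤ m := by exact_mod_cast hm2
  have hmc : (m : ℝ) ≤ c * L := Nat.floor_le (by positivity)
  have hmlog : 0 < Real.log m := Real.log_pos (by linarith)
  have hm0 : (0 : ℝ) < m := by linarith
  have hLL : 0 < L / Real.log L := by positivity
  have hs1 : e * (L / Real.log L) ≤ s := Nat.le_ceil _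
  have hs2 : (s : ℝ) ≤ e * (L / Real.log L) + 1 := (Nat.ceil_lt_add_one (by positivity)).le
  have hk1 : (d * L / 2 + Real.log L) ≤ k * Real.log m := by
    rw [← div_le_iff₀ hmlog]; exact Nat.le_ceil _
  have hk2 : (k : ℝ) ≤ (d * L / 2 + Real.log L) / Real.log m + 1 :=
    (Nat.ceil_lt_add_one (by positivity)).le
  have he1 : 1 ≤ e * (L / Real.log L) := by
    rw [div_le_iff₀ he0] at hL5; linarith
  have hsL : (s : ℝ) ≤ L := by
    have : 2 * e * (L / Real.log L) ≤ L := by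
      rw [mul_div_assoc', div_le_iff₀ (by linarith)]
      nlinarith
    linarith
  have hmk : (m : ℝ) ^ k = Real.exp (k * Real.log m) := by
    rw [Real.exp_nat_mul, Real.exp_log hm0]
  have hstep : (2 * s + 2 * k + 1 : ℝ) ≤ (1 + ε) * d * L / Real.log L := by
    have h1 : (2 * s + 2 * k + 1 : ℝ) ≤
        (2 * e + 5 * (Real.log L / L) + (d + 2 * (Real.log L / L)) * (Real.log L / Real.log m)) *
          (L / Real.log L) := by
      have h2 : (2 * e + 5 * (Real.log L / L) + (d + 2 * (Real.log L / L)) *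
          (Real.log L / Real.log m)) * (L / Real.log L) =
          2 * (e * (L / Real.log L)) + 5 + 2 * ((d * L / 2 + Real.log L) / Real.log m) := by
        field_simp
      rw [h2]
      linarith
    refine h1.trans ((mul_le_mul_of_nonneg_right hL1.le hLL.le).trans_eq ?_)
    ring
  refine ⟨m, s, k, hm2, hmc, hsL, ?_, ?_, hstep, ?_, ?_⟩
  · have h1 : (1 : ℝ) ≤ s := he1.trans hs1
    calc Real.exp (d * L / 2) * L = Real.exp (d * L / 2 + Real.log L) := by
          rw [Real.exp_add, Real.exp_log hL0]
      _ ≤ (m : ℝ) ^ k := by rw [hmk]; exact Real.exp_le_exp.2 hk1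
      _ ≤ s * (m : ℝ) ^ k := le_mul_of_one_le_left (by positivity) h1
  -- Rounding `k` up overshoots the target by at most one factor `m`; the resulting L^3 is absorbed
  -- by exp(d L / 4).
  · have h1 : (m : ℝ) ^ k ≤ Real.exp (d * L / 2) * L * (c * L) := by
      calc (m : ℝ) ^ k ≤ Real.exp (d * L / 2 + Real.log L + Real.log m) := by
            rw [hmk]
            refine Real.exp_le_exp.2 ?_
            have := mul_le_mul_of_nonneg_right hk2 hmlog.le
            rw [add_mul, div_mul_cancel₀ _ hmlog.ne'] at this
            linarith
        _ = Real.exp (d * L / 2) * L * m := by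
            rw [Real.exp_add, Real.exp_add, Real.exp_log hL0, Real.exp_log hm0]
        _ ≤ _ := by gcongr
    calc C * (s * (m : ℝ) ^ k) ≤ |C| * (L * (Real.exp (d * L / 2) * L * (c * L))) := by
          gcongr
          exact le_abs_self C
      _ = Real.exp (d * L / 2) * (|C| * c * L ^ 3) := by ring
      _ ≤ Real.exp (d * L / 2) * Real.exp (d / 4 * L) := by gcongr
      _ = Real.exp (3 / 4 * d * L) := by
          rw [← Real.exp_add]; congr 1; ring
  · have h1 : (1 + ε) * d * L / Real.log L ≤ Real.exp L := by
      have h2 : (1 + ε) * d * L / Real.log L ≤ L := by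
        rw [div_le_iff₀ (by linarith)]
        nlinarith
      have := Real.add_one_le_exp L
      linarith
    linarith [Nat.cast_nonneg (α := ℝ) s]
  · have h1 : c / 2 * L ≤ m := by
      have := Nat.lt_floor_add_one (c * L)
      rw [← hm] at this
      linarith
    calc e * (c / 2) * (L * (L / Real.log L)) = (e * (L / Real.log L)) * (c / 2 * L) := by ring
      _ ≤ s * m := by gcongr

end LongRangePercolation

/-! ### Passage to the limit and conclusion. -/

namespace LongRangePercolation

variable {d : ℕ} {β : ℝ}

theorem tendsto_exp_mul_sub {f : ℝ → ℝ} (hf : Tendsto f atTop atTop) (A : ℝ) {c : ℝ} (hc : 0 < c) :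
    Tendsto (fun L : ℝ => Real.exp (L * (A - c * f L))) atTop (𝓝 0) := by
  refine Real.tendsto_exp_atBot.comp (tendsto_id.atTop_mul_atBot₀ ?_)
  simpa only [sub_eq_add_neg, Function.comp_def] using
    tendsto_atBot_add_const_left _ A (tendsto_neg_atTop_atBot.comp (hf.const_mul_atTop hc))

theorem tendsto_log_natCast : Tendsto (fun N : ℕ => Real.log N) atTop atTop :=
  Real.tendsto_log_atTop.comp tendsto_natCast_atTop_atTop

theorem log_lt_natLog_add_one {N : ℕ} (hN : 0 < N) :
    Real.log N < (Nat.log 2 N + 1) * Real.log 2 := by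
  have h := Nat.lt_pow_succ_log_self one_lt_two N
  have h2 : (N : ℝ) < 2 ^ (Nat.log 2 N + 1) := by exact_mod_cast h
  have h3 := Real.log_lt_log (by exact_mod_cast hN) h2
  rw [Real.log_pow] at h3
  exact_mod_cast h3

theorem natLog_mul_log_two_le {N : ℕ} (hN : 0 < N) :
    Nat.log 2 N * Real.log 2 ≤ Real.log N := by
  have h := Nat.pow_log_le_self 2 hN.ne'
  have h2 : (2 : ℝ) ^ (Nat.log 2 N) ≤ N := by exact_mod_cast h
  have h3 := Real.log_le_log (by positivity) h2
  rwa [Real.log_pow] at h3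

theorem tendsto_law_lt_diameter (hd : 1 ≤ d) (hβ : 0 < β) {ε : ℝ} (hε : 0 < ε) :
    Tendsto (fun N : ℕ => (law d N β hβ).real {ω : Config d N |
      (1 + ε) * d * Real.log N / Real.log (Real.log N) < diameter ω}) atTop (𝓝 0) := by
  have hd0 : (0 : ℝ) < d := by exact_mod_cast hd
  -- 160 = 16 · 10: the factor 16 comes from the growth condition, the 10 from J ≥ L / 10.
  have hc : 0 < β / (160 * (2 * d) ^ d) := by positivity
  obtain ⟨c₂, hc₂, hpar⟩ := exists_exploration_parameters hd hε hc (8 + 4 * β)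
  have hg : Tendsto (fun L : ℝ => Real.exp (L * ((4 * d + 1) - c₂ * (L / Real.log L))) +
      Real.exp (L * (4 * d - β / d ^ d * L))) atTop (𝓝 0) := by
    simpa using (tendsto_exp_mul_sub tendsto_self_div_log (4 * d + 1) hc₂).add
      (tendsto_exp_mul_sub tendsto_id (4 * d) (show 0 < β / (d : ℝ) ^ d by positivity))
  refine squeeze_zero' (Eventually.of_forall fun _ => measureReal_nonneg) ?_
    (hg.comp tendsto_log_natCast)
  filter_upwards [tendsto_log_natCast.eventually hpar, eventually_gt_atTop 0,
    tendsto_log_natCast.eventually_ge_atTop 36] with N hN hN0 hL36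
  obtain ⟨m, s, k, hm2, hmc, hsL, hlow, hup, hstep, hk, hsm⟩ := hN
  set L := Real.log N with hL
  have hNpos : (0 : ℝ) < N := by exact_mod_cast hN0
  have hN1 : (1 : ℝ) ≤ N := by exact_mod_cast hN0
  have hexpL : Real.exp L = N := Real.exp_log hNpos
  set n := Nat.log 2 N with hn
  have hn1 : L < (n + 1) * Real.log 2 := log_lt_natLog_add_one hN0
  have hlog2 : Real.log 2 < 1 := Real.log_two_lt_d9.trans (by norm_num)
  have hlog2' : 0 < Real.log 2 := Real.log_pos (by norm_num)
  have hn2 : L < n + 1 := by nlinarith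
  have hn35 : 35 ≤ n := by
    have h : (35 : ℝ) < n := by linarith
    exact_mod_cast h.le
  -- About a fifth of the scales supplies a degree of order L, while 2^a is still at least N^{3/4};
  -- n ≥ 35 is what the rounding needs.
  obtain ⟨J, hJ⟩ : ∃ J, J = n / 5 := ⟨_, rfl⟩
  obtain ⟨a, ha⟩ : ∃ a, a = n - J - 1 := ⟨_, rfl⟩
  have h2N : 2 ^ (a + J + 1) ≤ N := by
    rw [show a + J + 1 = n by omega]
    exact Nat.pow_log_le_self 2 hN0.ne'
  have hJL : L / 10 ≤ J := by
    have h1 : n ≤ 5 * J + 4 := by omega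
    have h2 : (n : ℝ) ≤ 5 * J + 4 := by exact_mod_cast h1
    linarith
  have ha2 : Real.exp (3 / 4 * d * L) ≤ ((2 : ℝ) ^ a) ^ d := by
    have h1 : 4 * n ≤ 5 * a + 5 := by omega
    have h2 : (4 * n : ℝ) ≤ 5 * a + 5 := by exact_mod_cast h1
    have h3 : Real.exp (3 / 4 * L) ≤ (2 : ℝ) ^ a := by
      calc Real.exp (3 / 4 * L) ≤ Real.exp (a * Real.log 2) := by
            refine Real.exp_le_exp.2 ?_
            nlinarith
        _ = (2 : ℝ) ^ a := by rw [Real.exp_nat_mul, Real.exp_log two_pos]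
    calc Real.exp (3 / 4 * d * L) = Real.exp (3 / 4 * L) ^ d := by
          rw [← Real.exp_nat_mul]; congr 1; ring
      _ ≤ _ := by gcongr
  have hW0 : (0 : ℝ) ≤ s * m ^ k := by positivity
  have hsN : s ≤ N := by
    have h1 : (s : ℝ) ≤ N := by
      have := Real.add_one_le_exp L
      linarith
    exact_mod_cast h1
  have hW : 8 * (s * m ^ k) ≤ (2 ^ a) ^ d := by
    have h1 : (8 : ℝ) * (s * m ^ k) ≤ (2 ^ a) ^ d := by nlinarith
    exact_mod_cast h1
  have hWβ : β * (4 * (s * m ^ k)) ≤ ((2 : ℝ) ^ a) ^ d := by nlinarith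
  have hm : 16 * (2 * d) ^ d * m ≤ β * J := by
    calc (16 : ℝ) * (2 * d) ^ d * m ≤ 16 * (2 * d) ^ d * (β / (160 * (2 * d) ^ d) * L) := by
          gcongr
      _ = β * (L / 10) := by field_simp; norm_num
      _ ≤ β * J := by gcongr
  have hmain := law_lt_diameter_le (hβ := hβ) hd h2N hm hm2 hsN hW hWβ
  have hsub : {ω : Config d N | (1 + ε) * d * L / Real.log L < diameter ω} ⊆
      {ω | 2 * s + 2 * k + 1 < diameter ω} := by
    intro ω hω
    have h1 : (2 * s + 2 * k + 1 : ℝ) < diameter ω := hstep.trans_lt hω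
    exact_mod_cast h1
  refine (measureReal_mono hsub).trans (hmain.trans ?_)
  have hpow : ((N : ℝ) + 1) ^ (2 * d) ≤ Real.exp (4 * d * L) := by
    calc ((N : ℝ) + 1) ^ (2 * d) ≤ Real.exp (2 * L) ^ (2 * d) := by
          have : (N : ℝ) + 1 ≤ Real.exp (2 * L) := by
            rw [two_mul, Real.exp_add, hexpL]
            have h1 : (2 : ℝ) ≤ N := by
              have := Real.add_one_le_exp L
              linarith
            nlinarith
          gcongr
      _ = _ := by rw [← Real.exp_nat_mul]; congr 1; push_cast; ring
  have h1 : 2 * k * Real.exp (-(s * m : ℝ)) ≤ Real.exp L * Real.exp (-(c₂ * (L * (L / Real.log L)))) :=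
    mul_le_mul hk (Real.exp_le_exp.2 (neg_le_neg hsm)) (by positivity) (by positivity)
  have h2 : Real.exp (-(β * (s * m ^ k) ^ 2 / (d * N) ^ d)) ≤ Real.exp (-(β / d ^ d * L ^ 2)) := by
    refine Real.exp_le_exp.2 (neg_le_neg ?_)
    have h3 : (N : ℝ) ^ d * L ^ 2 ≤ (s * m ^ k) ^ 2 := by
      calc (N : ℝ) ^ d * L ^ 2 = (Real.exp (d * L / 2) * L) ^ 2 := by
            rw [mul_pow, ← Real.exp_nat_mul, ← hexpL, ← Real.exp_nat_mul]
            congr 2; push_cast; ring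
        _ ≤ _ := by gcongr
    rw [le_div_iff₀ (by positivity), mul_pow]
    calc β / (d : ℝ) ^ d * L ^ 2 * (d ^ d * N ^ d) = β * (N ^ d * L ^ 2) := by
          field_simp
      _ ≤ _ := by gcongr
  calc _ ≤ Real.exp (4 * d * L) * (Real.exp L * Real.exp (-(c₂ * (L * (L / Real.log L)))) +
        Real.exp (-(β / d ^ d * L ^ 2))) := by gcongr
    _ = _ := by
        rw [mul_add, ← Real.exp_add, ← Real.exp_add, ← Real.exp_add]
        simp only [Function.comp]
        congr 2 <;> ring

theorem tendsto_law_diameter_le (hd : 1 ≤ d) (hβ : 0 < β) {γ : ℝ} (hγ0 : 0 ≤ γ) (hγ : γ < d) :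
    Tendsto (fun N : ℕ => (law d N β hβ).real {ω : Config d N |
      (diameter ω : ℝ) ≤ γ * (Real.log N / Real.log (Real.log N))}) atTop (𝓝 0) := by
  have hd0 : (0 : ℝ) < d := by exact_mod_cast hd
  set A : ℝ := (β + 1) * 4 ^ d with hA
  have hA0 : 0 < A := by positivity
  set C : ℝ := 1 + A * (4 + 2 * Real.log d) with hC
  have hlogd : 0 ≤ Real.log d := Real.log_nonneg (by exact_mod_cast hd)
  have hC1 : 1 ≤ C := by
    have : 0 ≤ A * (4 + 2 * Real.log d) := by positivity
    linarith
  -- The constant in the degree bound only adds γ log C / log L, so the bracket tends to γ - d < 0.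
  have hg : Tendsto (fun L : ℝ => Real.exp (L * ((γ - d) + γ * Real.log C / Real.log L)))
      atTop (𝓝 0) := by
    refine Real.tendsto_exp_atBot.comp (tendsto_id.atTop_mul_neg (C := γ - d) (by linarith) ?_)
    simpa using (Real.tendsto_log_atTop.const_div_atTop (γ * Real.log C)).const_add (γ - d)
  refine squeeze_zero' (Eventually.of_forall fun _ => measureReal_nonneg) ?_
    (hg.comp tendsto_log_natCast)
  filter_upwards [eventually_gt_atTop 0, tendsto_log_natCast.eventually_gt_atTop (Real.exp 1)]
    with N hN0 hLe
  set L := Real.log N with hL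
  have hNpos : (0 : ℝ) < N := by exact_mod_cast hN0
  have hexpL : Real.exp L = N := Real.exp_log hNpos
  have hL0 : 0 < L := (Real.exp_pos 1).trans hLe
  have hL1 : 1 < L := by
    have := Real.add_one_le_exp (1 : ℝ)
    linarith
  have hlog : 1 < Real.log L := (Real.lt_log_iff_exp_lt hL0).2 hLe
  set K := ⌊γ * (L / Real.log L)⌋₊ with hK
  have hKle : (K : ℝ) ≤ γ * (L / Real.log L) := Nat.floor_le (by positivity)
  have hsub : {ω : Config d N | (diameter ω : ℝ) ≤ γ * (L / Real.log L)} ⊆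
      {ω | diameter ω ≤ K} := fun ω hω => Nat.le_floor hω
  refine (measureReal_mono hsub).trans ((law_diameter_le_le hβ K).trans ?_)
  have hbase : 1 + (β + 1) * (4 ^ d * ((Nat.log 2 (d * N) : ℝ) + 1)) ≤ C * L := by
    have h1 := natLog_mul_log_two_le (N := d * N) (by positivity)
    push_cast at h1
    rw [Real.log_mul hd0.ne' hNpos.ne', ← hL] at h1
    have h2 : (1 : ℝ) / 2 ≤ Real.log 2 := (by norm_num : (1 : ℝ) / 2 ≤ 0.69).trans
      ((by norm_num : (0.69 : ℝ) ≤ 0.6931471803).trans Real.log_two_gt_d9.le)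
    have h3 : (Nat.log 2 (d * N) : ℝ) ≤ 2 * (Real.log d + L) := by
      nlinarith [Nat.cast_nonneg (α := ℝ) (Nat.log 2 (d * N))]
    have h4 : (Nat.log 2 (d * N) : ℝ) + 1 ≤ (4 + 2 * Real.log d) * L := by nlinarith
    calc 1 + (β + 1) * (4 ^ d * ((Nat.log 2 (d * N) : ℝ) + 1))
        = 1 + A * ((Nat.log 2 (d * N) : ℝ) + 1) := by rw [hA]; ring
      _ ≤ L + A * ((4 + 2 * Real.log d) * L) := by gcongr
      _ = C * L := by rw [hC]; ring
  have hCL : 0 < C * L := by positivity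
  have hlogCL : 0 ≤ Real.log (C * L) := Real.log_nonneg (by nlinarith)
  calc _ ≤ (C * L) ^ K / (N : ℝ) ^ d := by
        gcongr
        linarith
    _ = Real.exp (K * Real.log (C * L) - d * L) := by
        rw [Real.exp_sub, Real.exp_nat_mul, Real.exp_log hCL, Real.exp_nat_mul, hexpL]
    _ ≤ Real.exp (γ * (L / Real.log L) * Real.log (C * L) - d * L) := by gcongr
    _ = _ := by
        rw [Real.log_mul (by positivity) hL0.ne']
        simp only [Function.comp, ← hL]
        congr 1
        field_simp
        ring

end LongRangePercolation

theorem theorem1 (d : ℕ) (hd : 1 ≤ d) (β : ℝ) (hβ : 0 < β) :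
    (∀ ε : ℝ, 0 < ε →
      Tendsto (fun N : ℕ => law d N β hβ {ω : Config d N |
          (diameter ω : ℝ) ≤ (1 + ε) * d * Real.log N / Real.log (Real.log N)})
        atTop (𝓝 1)) ∧
    (∀ δ : ℝ, 0 < δ →
      Tendsto (fun N : ℕ => law d N β hβ {ω : Config d N |
          δ ≤ |(diameter ω : ℝ) * (Real.log (Real.log N) / Real.log N) - d|})
        atTop (𝓝 0)) := by
  have hd0 : (0 : ℝ) < d := by exact_mod_cast hd
  constructor
  · intro ε hε
    rw [← ENNReal.ofReal_one]
    have h := (tendsto_law_lt_diameter hd hβ hε).const_sub 1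
    rw [sub_zero] at h
    refine (ENNReal.tendsto_ofReal h).congr fun N => ?_
    rw [← probReal_compl_eq_one_sub (Set.toFinite _).measurableSet, ofReal_measureReal]
    congr 1
    ext ω
    simp
  · intro δ hδ
    rw [← ENNReal.ofReal_zero]
    -- Half of δ leaves room for the strict inequality; truncating d - δ at 0 below meets the
    -- requirement γ ≥ 0.
    have h1 := tendsto_law_lt_diameter (ε := δ / (2 * d)) hd hβ (by positivity)
    have h2 := tendsto_law_diameter_le (γ := max (d - δ) 0) hd hβ (le_max_right _ _)
      (max_lt (by linarith) hd0)
    have h := h1.add h2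
    rw [add_zero] at h
    have h3 : Tendsto (fun N : ℕ => (law d N β hβ).real {ω : Config d N |
        δ ≤ |(diameter ω : ℝ) * (Real.log (Real.log N) / Real.log N) - d|}) atTop (𝓝 0) := by
      refine squeeze_zero' (Eventually.of_forall fun _ => measureReal_nonneg) ?_ h
      filter_upwards [tendsto_log_natCast.eventually_gt_atTop (Real.exp 1)] with N hLe
      set L := Real.log N with hL
      have hL0 : 0 < L := (Real.exp_pos 1).trans hLe
      have hlog : 1 < Real.log L := (Real.lt_log_iff_exp_lt hL0).2 hLe
      refine (measureReal_mono fun ω hω => ?_).trans (measureReal_union_le _ _)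
      have hpos : 0 < L / Real.log L := by positivity
      have e : (diameter ω : ℝ) =
          diameter ω * (Real.log L / L) * (L / Real.log L) := by field_simp
      rcases le_abs'.1 (show δ ≤ |(diameter ω : ℝ) * (Real.log L / L) - d| from hω) with h | h
      · right
        change (diameter ω : ℝ) ≤ max (d - δ) 0 * (L / Real.log L)
        rw [e]
        refine mul_le_mul_of_nonneg_right (le_trans ?_ (le_max_left _ _)) hpos.le
        linarith
      · left
        change (1 + δ / (2 * d)) * d * L / Real.log L < (diameter ω : ℝ)
        have e2 : (1 + δ / (2 * d)) * d * L / Real.log L = (d + δ / 2) * (L / Real.log L) := by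
          field_simp
        rw [e, e2]
        exact mul_lt_mul_of_pos_right (by linarith) hpos
    refine (ENNReal.tendsto_ofReal h3).congr fun N => ?_
    rw [ofReal_measureReal]
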